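/- All graphs are finite and simple. For a connected graph $G$ with vertices $v_1,\dots,v_n$, let $r_G(v_i,v_j)$ be the resistance distance between $v_i$ and $v_j$, i.e. the effective resistance between them when every edge of $G$ is a unit resistor, and let $Kf(G)=\sum_{i<j} r_G(v_i,v_j)$ be the Kirchhoff index of $G$. For integers $1\le p\le n-1$ let $K_n-K_{1,p}$ be the graph obtained from the complete graph $K_n$ by deleting the $p$ edges of a star $K_{1,p}\subseteq K_n$. Let $n$ and $p$ be integers with $2\le p\le\lfloor n/2\rfloor$, and let $G$ be any graph obtained by deleting $p$ edges from $K_n$ (such a graph is connected). Let $\delta$ be the minimum degree of $G$. Then $$Kf(G)\le n-1-p+\frac{n}{n-p-1}+\frac{n(p-1)\delta}{(n-1)(n-p-1)},$$ and equality holds if and only if $G\cong K_n-K_{1,p}$. -/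

import Mathlib

/-- Regard the graph `G` as an electrical network in which every edge is a unit resistor.
`G.IsUnitCurrentPotential i j φ` says that `φ` is an electric potential on the vertices for the
situation in which one unit of current enters the network at `i` and leaves it at `j`: by Ohm's law
the current along an edge from `v` to `w` is `φ v - φ w`, and by Kirchhoff's current law
the total current flowing from `v` into the network is `1` at `i`, `-1` at `j`, and `0` elsewhere
(everywhere `0` if `i = j`). -/
def SimpleGraph.IsUnitCurrentPotential {V : Type*} [Fintype V] [DecidableEq V]
    (G : SimpleGraph V) [DecidableRel G.Adj] (i j : V) (φ : V → ℝ) : Prop :=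
  ∀ v : V, ∑ w ∈ G.neighborFinset v, (φ v - φ w)
    = (if v = i then 1 else 0) - (if v = j then 1 else 0)

open Classical in
/-- The resistance distance between `i` and `j`: the effective resistance between them when every
edge is a unit resistor, that is, the potential difference between `i` and `j` when one unit of
current is sent from `i` to `j`. In a connected graph such a potential exists and the difference
does not depend on its choice, as proved below. -/
noncomputable def SimpleGraph.resistanceDist {V : Type*} [Fintype V] [DecidableEq V]
    (G : SimpleGraph V) [DecidableRel G.Adj] (i j : V) : ℝ :=
  if h : ∃ φ : V → ℝ, G.IsUnitCurrentPotential i j φ then h.choose i - h.choose j else 0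

/-- The Kirchhoff index `Kf(G) = ∑_{i < j} r_G(i, j)` of a graph on the vertices `0, …, n - 1`. -/
noncomputable def SimpleGraph.kirchhoffIndex {n : ℕ} (G : SimpleGraph (Fin n))
    [DecidableRel G.Adj] : ℝ :=
  ∑ i : Fin n, ∑ j ∈ Finset.Ioi i, G.resistanceDist i j

/-- The star with centre `0` and leaves `1, …, p`, as a graph on the vertices `0, …, n - 1`
(the remaining vertices are isolated). For `p < n` its edges form a copy of `K_{1,p}` in `K_n`. -/
def starSubgraph (n p : ℕ) : SimpleGraph (Fin n) :=
  SimpleGraph.fromRel fun u v => (u : ℕ) = 0 ∧ 1 ≤ (v : ℕ) ∧ (v : ℕ) ≤ p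

/-- The graph `K_n - K_{1,p}`: all edges of a star `K_{1,p}` are deleted from `K_n`. -/
def completeMinusStar (n p : ℕ) : SimpleGraph (Fin n) :=
  (⊤ : SimpleGraph (Fin n)).deleteEdges (starSubgraph n p).edgeSet

theorem SimpleGraph.isUnitCurrentPotential_iff {V : Type*} [Fintype V] [DecidableEq V]
    (G : SimpleGraph V) [DecidableRel G.Adj] (i j : V) (φ : V → ℝ) :
    G.IsUnitCurrentPotential i j φ ↔
      (G.lapMatrix ℝ).mulVec φ = Pi.single i 1 - Pi.single j 1 := by
  unfold SimpleGraph.IsUnitCurrentPotential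
  rw [funext_iff]
  refine forall_congr' fun v => ?_
  rw [SimpleGraph.lapMatrix_mulVec_apply, Finset.sum_sub_distrib]
  simp [Pi.single_apply]

theorem SimpleGraph.exists_isUnitCurrentPotential {V : Type*} [Fintype V] [DecidableEq V]
    (G : SimpleGraph V) [DecidableRel G.Adj] (hG : G.Connected) (i j : V) :
    ∃ φ : V → ℝ, G.IsUnitCurrentPotential i j φ := by
  have hone : ∀ x : V → ℝ, ∑ v, (G.lapMatrix ℝ).mulVec x v = 0 := by
    intro x
    have h1 : Matrix.vecMul (fun _ => (1 : ℝ)) (G.lapMatrix ℝ) = 0 := by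
      rw [← Matrix.mulVec_transpose, (G.isSymm_lapMatrix (R := ℝ)).eq]
      exact G.lapMatrix_mulVec_const_eq_zero
    have h2 := Matrix.dotProduct_mulVec (fun _ => (1 : ℝ)) (G.lapMatrix ℝ) x
    rw [h1, zero_dotProduct] at h2
    simpa [dotProduct] using h2
  have hcard : (Fintype.card V : ℝ) ≠ 0 := by
    have : Nonempty V := hG.nonempty
    exact_mod_cast Fintype.card_ne_zero
  let T : (V → ℝ) →ₗ[ℝ] (V → ℝ) :=
    (G.lapMatrix ℝ).mulVecLin + (LinearMap.pi fun _ => ∑ v, LinearMap.proj v)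
  have hT : ∀ x v, T x v = (G.lapMatrix ℝ).mulVec x v + ∑ w, x w := by
    intro x v
    simp [T]
  have hsum : ∀ x, ∑ v, T x v = Fintype.card V * ∑ w, x w := by
    intro x
    simp [hT, Finset.sum_add_distrib, hone]
  have hinj : Function.Injective T := by
    rw [← LinearMap.ker_eq_bot, LinearMap.ker_eq_bot']
    intro x hx
    have h0 : ∑ w, x w = 0 := by
      have := hsum x
      simpa [hx, hcard] using this
    have hL : (G.lapMatrix ℝ).mulVec x = 0 := by
      ext v
      have := hT x v
      simpa [hx, h0] using this.symm
    rw [G.lapMatrix_mulVec_eq_zero_iff_forall_reachable] at hL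
    ext v
    have h3 : ∑ w, x w = Fintype.card V * x v := by
      rw [Finset.sum_congr rfl fun w _ => hL w v (hG.preconnected w v)]
      simp
    rw [h0] at h3
    simpa [hcard] using h3.symm
  obtain ⟨φ, hφ⟩ := LinearMap.surjective_of_injective hinj (Pi.single i 1 - Pi.single j 1)
  refine ⟨φ, (G.isUnitCurrentPotential_iff i j φ).2 ?_⟩
  have h0 : ∑ w, φ w = 0 := by
    have := hsum φ
    simpa [hφ, hcard] using this
  ext v
  rw [← hφ, hT, h0, add_zero]

theorem SimpleGraph.resistanceDist_eq {V : Type*} [Fintype V] [DecidableEq V]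
    (G : SimpleGraph V) [DecidableRel G.Adj] (hG : G.Connected) {i j : V} {φ : V → ℝ}
    (hφ : G.IsUnitCurrentPotential i j φ) : G.resistanceDist i j = φ i - φ j := by
  have h : ∃ ψ : V → ℝ, G.IsUnitCurrentPotential i j ψ := ⟨φ, hφ⟩
  rw [SimpleGraph.resistanceDist, dif_pos h]
  have h1 := (G.isUnitCurrentPotential_iff i j _).1 h.choose_spec
  have h2 := (G.isUnitCurrentPotential_iff i j φ).1 hφ
  have h3 : (G.lapMatrix ℝ).mulVec (h.choose - φ) = 0 := by
    rw [Matrix.mulVec_sub, h1, h2, sub_self]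
  rw [G.lapMatrix_mulVec_eq_zero_iff_forall_reachable] at h3
  have h4 := h3 i j (hG.preconnected i j)
  simp only [Pi.sub_apply] at h4
  linarith

/-! Orient the `p` missing edges and let `B` be their incidence matrix, so that `L = n - J - B Bᵀ`.
Then `L + J = n - B Bᵀ` has inverse `(1 + B X Bᵀ) / n`, where `X = (n - BᵀB)⁻¹` is only `p × p`.
Reading resistances off this inverse gives `Kf = n - 1 - p + n tr X` (`kirchhoffIndex_eq_trace`).

The Gram matrix `BᵀB` has diagonal `2` and off-diagonal entries of absolute value at most `1`. For a
star oriented from its centre it is `1 + J`, the extreme case, and `inv_scalar_sub_diag_le` bounds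
each diagonal entry of `X` by its value there. Hence `Kf(G)` is at most the Kirchhoff index of `K_n
- K_{1,p}`.

The stated bound is this star value plus a positive multiple of `δ - (n - 1 - p)`, which is
nonnegative because a vertex loses at most `p` edges. Equality therefore forces `δ = n - 1 - p`:
some vertex lies on all missing edges, and they form a star. The equality case of the matrix
estimate is never needed. -/

/-! ### Diagonal dominance and an entrywise bound on the inverse -/

open Matrix in
theorem det_scalar_sub_ne_zero {ι : Type*} [Fintype ι] [DecidableEq ι] {N : Matrix ι ι ℝ} {c : ℝ}
    (hdiag : ∀ e, N e e = 2) (hoff : ∀ e f, e ≠ f → |N e f| ≤ 1)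
    (hc : (Fintype.card ι : ℝ) + 1 < c) : (c • (1 : Matrix ι ι ℝ) - N).det ≠ 0 := by
  -- The diagonal is `c - 2` and the rest of a row sums to at most `card ι - 1` in absolute value,
  -- so `hc` is strict diagonal dominance.
  refine det_ne_zero_of_sum_row_lt_diag fun k => ?_
  have hcard : (((Finset.univ.erase k).card : ℕ) : ℝ) = Fintype.card ι - 1 := by
    rw [Finset.card_erase_of_mem (Finset.mem_univ k), Finset.card_univ,
      Nat.cast_sub (Fintype.card_pos_iff.2 ⟨k⟩), Nat.cast_one]
  have hp : (1 : ℝ) ≤ Fintype.card ι := by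
    exact_mod_cast Fintype.card_pos_iff.2 ⟨k⟩
  have h1 : ∑ j ∈ Finset.univ.erase k, ‖(c • (1 : Matrix ι ι ℝ) - N) k j‖
      ≤ ∑ _j ∈ Finset.univ.erase k, (1 : ℝ) := by
    refine Finset.sum_le_sum fun j hj => ?_
    have hj' : k ≠ j := (Finset.ne_of_mem_erase hj).symm
    simpa [hj'] using hoff k j hj'
  rw [Finset.sum_const, nsmul_eq_mul, mul_one, hcard] at h1
  have h2 : ‖(c • (1 : Matrix ι ι ℝ) - N) k k‖ = c - 2 := by
    rw [Real.norm_eq_abs]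
    simp only [Matrix.sub_apply, Matrix.smul_apply, one_apply_eq, hdiag, smul_eq_mul, mul_one]
    exact abs_of_pos (by linarith)
  rw [h2]
  linarith

open Matrix in
/-- Entrywise comparison of the inverse of `c - N` with the inverse of `(c - 1) - J`, where `J` is
the all-ones matrix. -/
theorem inv_scalar_sub_diag_le {ι : Type*} [Fintype ι] [DecidableEq ι] {N : Matrix ι ι ℝ} {c : ℝ}
    (hdiag : ∀ e, N e e = 2) (hoff : ∀ e f, e ≠ f → |N e f| ≤ 1)
    (hc : (Fintype.card ι : ℝ) + 1 < c) (e : ι) :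
    (c • (1 : Matrix ι ι ℝ) - N)⁻¹ e e
      ≤ (c - Fintype.card ι) / ((c - 1) * (c - 1 - Fintype.card ι)) := by
  set X := (c • (1 : Matrix ι ι ℝ) - N)⁻¹ with hX
  have hmul : (c • (1 : Matrix ι ι ℝ) - N) * X = 1 :=
    mul_nonsing_inv _ (isUnit_iff_ne_zero.2 (det_scalar_sub_ne_zero hdiag hoff hc))
  have hp : (0 : ℝ) ≤ Fintype.card ι := Nat.cast_nonneg _
  set s := ∑ k, |X k e| with hs
  -- Row `i` of `(c - N) X = 1` bounds `(c - 2) |X i e|` by the indicator plus the other absolute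
  -- values in column `e`; completing these to `s` turns `c - 2` into `c - 1`.
  have hrow : ∀ i, (c - 1) * |X i e| ≤ (if i = e then 1 else 0) + s := by
    intro i
    have h1 : c * X i e - ∑ k, N i k * X k e = if i = e then 1 else 0 := by
      have := congrFun (congrFun hmul i) e
      rwa [Matrix.sub_mul, Matrix.smul_mul, Matrix.one_mul, Matrix.sub_apply, Matrix.smul_apply,
        mul_apply, one_apply, smul_eq_mul] at this
    rw [← Finset.add_sum_erase _ _ (Finset.mem_univ i), hdiag] at h1
    have h2 : |∑ k ∈ Finset.univ.erase i, N i k * X k e| ≤ s - |X i e| := by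
      rw [hs, ← Finset.add_sum_erase _ _ (Finset.mem_univ i), add_sub_cancel_left]
      refine (Finset.abs_sum_le_sum_abs _ _).trans (Finset.sum_le_sum fun k hk => ?_)
      rw [abs_mul]
      exact mul_le_of_le_one_left (abs_nonneg _) (hoff i k (Finset.ne_of_mem_erase hk).symm)
    have h3 : (c - 2) * |X i e| = |(if i = e then 1 else 0)
        + ∑ k ∈ Finset.univ.erase i, N i k * X k e| := by
      have hpos : 0 < c - 2 := by
        have : (1 : ℝ) ≤ Fintype.card ι := by exact_mod_cast Fintype.card_pos_iff.2 ⟨e⟩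
        linarith
      nth_rewrite 1 [← h1, ← abs_of_pos hpos, ← abs_mul]
      congr 1
      ring
    have h4 := abs_add_le (if i = e then (1 : ℝ) else 0)
      (∑ k ∈ Finset.univ.erase i, N i k * X k e)
    have h5 : |if i = e then (1 : ℝ) else 0| = if i = e then 1 else 0 := by
      split_ifs <;> simp
    linarith
  -- Summing over `i` bounds `s` in terms of itself; the result goes back into the row `i = e`.
  have hsum : (c - 1) * s ≤ 1 + Fintype.card ι * s := by
    have := Finset.sum_le_sum fun i (_ : i ∈ Finset.univ) => hrow i
    simpa [← Finset.mul_sum, Finset.sum_add_distrib, ← hs] using this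
  have hpos : 0 < c - 1 - Fintype.card ι := by linarith
  have hs' : s ≤ 1 / (c - 1 - Fintype.card ι) := by
    rw [le_div_iff₀ hpos]
    linarith
  have he := hrow e
  rw [if_pos rfl] at he
  have hc1 : 0 < c - 1 := by linarith
  refine (le_abs_self _).trans ?_
  rw [le_div_iff₀ (mul_pos hc1 hpos)]
  rw [le_div_iff₀ hpos] at hs'
  nlinarith

/-! ### Incidence matrix of the missing edges -/

/-- The vertex-edge incidence matrix of the edges directed from `a e` to `b e`. -/
def orientedIncidence {V ι : Type*} [DecidableEq V] (a b : ι → V) : Matrix V ι ℝ :=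
  Matrix.of fun v e => (if v = a e then 1 else 0) - (if v = b e then 1 else 0)

theorem orientedIncidence_transpose_mulVec {V ι : Type*} [Fintype V] [DecidableEq V]
    (a b : ι → V) (φ : V → ℝ) (e : ι) :
    (orientedIncidence a b).transpose.mulVec φ e = φ (a e) - φ (b e) := by
  simp [orientedIncidence, Matrix.mulVec, dotProduct, sub_mul, Finset.sum_sub_distrib]

theorem orientedIncidence_gram_apply {V ι : Type*} [Fintype V] [DecidableEq V]
    (a b : ι → V) (e f : ι) :
    ((orientedIncidence a b).transpose * orientedIncidence a b) e f
      = ((if a e = a f then 1 else 0) - (if a e = b f then 1 else 0))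
        - ((if b e = a f then 1 else 0) - (if b e = b f then 1 else 0)) :=
  orientedIncidence_transpose_mulVec a b (fun v => orientedIncidence a b v f) e

theorem orientedIncidence_gram_diag {V ι : Type*} [Fintype V] [DecidableEq V]
    {a b : ι → V} (hne : ∀ e, a e ≠ b e) (e : ι) :
    ((orientedIncidence a b).transpose * orientedIncidence a b) e e = 2 := by
  rw [orientedIncidence_gram_apply]
  simp [hne e, (hne e).symm]
  norm_num

/-- Two distinct edges share at most one endpoint, so at most one of the four indicators in the Gram
entry is nonzero. -/
theorem abs_orientedIncidence_gram_le {V ι : Type*} [Fintype V] [DecidableEq V]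
    {a b : ι → V} (hne : ∀ e, a e ≠ b e)
    (hinj : Function.Injective fun e => s(a e, b e)) {e f : ι} (hef : e ≠ f) :
    |((orientedIncidence a b).transpose * orientedIncidence a b) e f| ≤ 1 := by
  have h := fun h => hef (@hinj e f h)
  simp only [Sym2.eq_iff] at h
  have h1 := hne e
  have h2 := hne f
  rw [orientedIncidence_gram_apply]
  by_cases h3 : a e = a f <;> by_cases h4 : a e = b f <;> by_cases h5 : b e = a f <;>
    by_cases h6 : b e = b f <;> simp_all

theorem sum_col_orientedIncidence {V ι : Type*} [Fintype V] [DecidableEq V]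
    (a b : ι → V) (e : ι) : ∑ v, orientedIncidence a b v e = 0 := by
  simp [orientedIncidence]

/-- The Laplacian of the graph whose missing edges are exactly `s(a e, b e)`. -/
theorem lapMatrix_eq_of_missing {V ι : Type*} [Fintype V] [DecidableEq V] [Fintype ι]
    (G : SimpleGraph V) [DecidableRel G.Adj] {a b : ι → V} (hne : ∀ e, a e ≠ b e)
    (hinj : Function.Injective fun e => s(a e, b e))
    (hadj : ∀ u v, G.Adj u v ↔ u ≠ v ∧ ∀ e, s(a e, b e) ≠ s(u, v)) (φ : V → ℝ) (v : V) :
    (G.lapMatrix ℝ).mulVec φ v = Fintype.card V * φ v - ∑ w, φ w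
      - (orientedIncidence a b * (orientedIncidence a b).transpose).mulVec φ v := by
  classical
  have h1 : (G.lapMatrix ℝ).mulVec φ v = ∑ w, if G.Adj v w then φ v - φ w else 0 := by
    rw [SimpleGraph.lapMatrix_mulVec_apply, ← Finset.sum_filter,
      ← SimpleGraph.neighborFinset_eq_filter, Finset.sum_sub_distrib]
    simp
  -- Whichever way `e` is oriented, it contributes to `B Bᵀ φ` at an endpoint `v` the drop from `v`
  -- to the other endpoint.
  have h2 : ∀ e, orientedIncidence a b v e * (φ (a e) - φ (b e))
      = ∑ w, if s(a e, b e) = s(v, w) then φ v - φ w else 0 := by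
    intro e
    have h := hne e
    by_cases h3 : v = a e
    · subst h3
      have : ∀ w, (s(a e, b e) = s(a e, w)) ↔ b e = w := by
        intro w
        simp only [Sym2.eq_iff, true_and, or_iff_left_iff_imp]
        rintro ⟨h4, h5⟩
        exact absurd h5.symm h
      simp [orientedIncidence, h, this]
    · by_cases h4 : v = b e
      · subst h4
        have : ∀ w, (s(a e, b e) = s(b e, w)) ↔ a e = w := by
          intro w; simp [h]
        simp [orientedIncidence, h.symm, this]
      · have : ∀ w, ¬ (s(a e, b e) = s(v, w)) := by
          intro w; simp [Ne.symm h3, Ne.symm h4]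
        simp [orientedIncidence, h3, h4, this]
  rw [← Matrix.mulVec_mulVec]
  have h3 : (orientedIncidence a b).mulVec ((orientedIncidence a b).transpose.mulVec φ) v
      = ∑ w, ∑ e, if s(a e, b e) = s(v, w) then φ v - φ w else 0 := by
    rw [Finset.sum_comm]
    simp only [Matrix.mulVec, dotProduct]
    refine Finset.sum_congr rfl fun e _ => ?_
    rw [← h2, ← orientedIncidence_transpose_mulVec]
    rfl
  have h4 : (Fintype.card V : ℝ) * φ v - ∑ w, φ w = ∑ w, (φ v - φ w) := by
    simp [Finset.sum_sub_distrib]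
  rw [h1, h3, h4, ← Finset.sum_sub_distrib]
  refine Finset.sum_congr rfl fun w _ => ?_
  by_cases hvw : v = w
  · simp [hvw]
  by_cases hw : ∃ e, s(a e, b e) = s(v, w)
  · obtain ⟨e, he⟩ := hw
    have hn : ¬ G.Adj v w := fun h => ((hadj v w).1 h).2 e he
    have : ∀ f, s(a f, b f) = s(v, w) ↔ f = e := fun f =>
      ⟨fun hf => hinj (hf.trans he.symm), fun hf => hf ▸ he⟩
    simp [hn, this]
  · push Not at hw
    simp [(hadj v w).2 ⟨hvw, hw⟩, hw]

/-! ### Kirchhoff index as a trace -/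

/-- The summand is symmetric in `i, j` and vanishes on the diagonal, so the sum is half of the full
double sum. -/
theorem sum_Ioi_symmetrized {n : ℕ} (Z : Matrix (Fin n) (Fin n) ℝ) :
    ∑ i : Fin n, ∑ j ∈ Finset.Ioi i, ((Z i i - Z i j) - (Z j i - Z j j))
      = n * Z.trace - ∑ i, ∑ j, Z i j := by
  set g : Fin n → Fin n → ℝ := fun i j => (Z i i - Z i j) - (Z j i - Z j j) with hg
  have hsymm : ∀ i j, g i j = g j i := fun i j => by simp only [hg]; ring
  have hdiag : ∀ i, g i i = 0 := fun i => by simp [hg]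
  have h1 : ∑ i, ∑ j ∈ Finset.Ioi i, g i j = ∑ i, ∑ j, if i < j then g i j else 0 :=
    Finset.sum_congr rfl fun i _ => by
      rw [← Finset.sum_filter]
      exact Finset.sum_congr (by ext; simp) fun _ _ => rfl
  have h2 : ∑ i, ∑ j, (if i < j then g i j else 0) = ∑ i, ∑ j, if j < i then g i j else 0 := by
    rw [Finset.sum_comm]
    exact Finset.sum_congr rfl fun i _ => Finset.sum_congr rfl fun j _ => by rw [hsymm]
  have h3 : ∑ i, ∑ j, g i j = 2 * ∑ i, ∑ j, if i < j then g i j else 0 := by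
    rw [two_mul]
    nth_rewrite 2 [h2]
    rw [← Finset.sum_add_distrib]
    refine Finset.sum_congr rfl fun i _ => ?_
    rw [← Finset.sum_add_distrib]
    refine Finset.sum_congr rfl fun j _ => ?_
    rcases lt_trichotomy i j with h | h | h
    · simp [h, h.not_gt]
    · simp [h, hdiag]
    · simp [h, h.not_gt]
  have h4 : ∑ i, ∑ j, g i j = 2 * (n * Z.trace - ∑ i, ∑ j, Z i j) := by
    simp only [hg, Finset.sum_sub_distrib, Finset.sum_const, Finset.card_univ, Fintype.card_fin,
      nsmul_eq_mul, ← Finset.mul_sum, Matrix.trace, Matrix.diag]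
    rw [Finset.sum_comm (f := fun i j => Z j i)]
    ring
  linarith

open Matrix in
/-- The inverse of `G.lapMatrix + J`, for the graph with missing edges `s(a e, b e)`. -/
noncomputable def greenMatrix {V ι : Type*} [Fintype V] [DecidableEq V] [Fintype ι]
    [DecidableEq ι] (a b : ι → V) : Matrix V V ℝ :=
  (Fintype.card V : ℝ)⁻¹ • (1 + orientedIncidence a b *
    ((Fintype.card V : ℝ) • 1 - (orientedIncidence a b)ᵀ * orientedIncidence a b)⁻¹ *
      (orientedIncidence a b)ᵀ)

-- A Woodbury identity: `BᵀB X = n X - 1` gives `B Bᵀ (B X Bᵀ) = n B X Bᵀ - B Bᵀ`, and the product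
-- telescopes to `n`, cancelled by the scalar factor.
open Matrix in
theorem mul_greenMatrix {V ι : Type*} [Fintype V] [DecidableEq V] [Fintype ι] [DecidableEq ι]
    {a b : ι → V} (hne : ∀ e, a e ≠ b e) (hinj : Function.Injective fun e => s(a e, b e))
    (hc : (Fintype.card ι : ℝ) + 1 < Fintype.card V) :
    ((Fintype.card V : ℝ) • 1 - orientedIncidence a b * (orientedIncidence a b)ᵀ)
      * greenMatrix a b = 1 := by
  have hV : (Fintype.card V : ℝ) ≠ 0 := by
    have : (0 : ℝ) ≤ Fintype.card ι := Nat.cast_nonneg _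
    linarith
  unfold greenMatrix
  set c : ℝ := (Fintype.card V : ℝ)
  set B := orientedIncidence a b with hB
  have hmul : (c • (1 : Matrix ι ι ℝ) - Bᵀ * B) * (c • (1 : Matrix ι ι ℝ) - Bᵀ * B)⁻¹ = 1 :=
    mul_nonsing_inv _ (isUnit_iff_ne_zero.2 (det_scalar_sub_ne_zero
      (orientedIncidence_gram_diag hne) (fun _ _ => abs_orientedIncidence_gram_le hne hinj) hc))
  set X := (c • (1 : Matrix ι ι ℝ) - Bᵀ * B)⁻¹
  have h1 : Bᵀ * B * X = c • X - 1 := by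
    rw [← hmul, sub_mul, smul_mul, one_mul]
    abel
  have h2 : B * Bᵀ * (B * X * Bᵀ) = c • (B * X * Bᵀ) - B * Bᵀ := by
    calc B * Bᵀ * (B * X * Bᵀ) = B * (Bᵀ * B * X) * Bᵀ := by simp only [Matrix.mul_assoc]
      _ = _ := by
        rw [h1, Matrix.mul_sub, Matrix.sub_mul, Matrix.mul_one, Matrix.mul_smul, Matrix.smul_mul]
  have h3 : (c • 1 - B * Bᵀ) * (1 + B * X * Bᵀ) = c • (1 : Matrix V V ℝ) := by
    rw [Matrix.mul_add, Matrix.mul_one, Matrix.sub_mul, h2, Matrix.smul_mul, Matrix.one_mul]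
    abel
  rw [Matrix.mul_smul, h3, smul_smul, inv_mul_cancel₀ hV, one_smul]

-- The columns of `B` sum to zero, so only the identity contributes. Equal column sums make `J`
-- vanish on differences of columns.
open Matrix in
theorem sum_col_greenMatrix {V ι : Type*} [Fintype V] [DecidableEq V] [Fintype ι] [DecidableEq ι]
    (a b : ι → V) (j : V) : ∑ i, greenMatrix a b i j = (Fintype.card V : ℝ)⁻¹ := by
  unfold greenMatrix
  set X := ((Fintype.card V : ℝ) • (1 : Matrix ι ι ℝ)
    - (orientedIncidence a b)ᵀ * orientedIncidence a b)⁻¹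
  have h : ∑ i, (orientedIncidence a b * X * (orientedIncidence a b)ᵀ) i j = 0 := by
    rw [Matrix.mul_assoc]
    simp only [mul_apply (M := orientedIncidence a b)]
    rw [Finset.sum_comm]
    refine Finset.sum_eq_zero fun e _ => ?_
    rw [← Finset.sum_mul, sum_col_orientedIncidence, zero_mul]
  simp only [Matrix.smul_apply, Matrix.add_apply, smul_eq_mul]
  rw [← Finset.mul_sum, Finset.sum_add_distrib, h]
  simp [one_apply]

-- Cyclicity of the trace replaces `B X Bᵀ` by `BᵀB X = n X - 1`.
open Matrix in
theorem card_mul_trace_greenMatrix {V ι : Type*} [Fintype V] [DecidableEq V] [Fintype ι]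
    [DecidableEq ι] {a b : ι → V} (hne : ∀ e, a e ≠ b e)
    (hinj : Function.Injective fun e => s(a e, b e))
    (hc : (Fintype.card ι : ℝ) + 1 < Fintype.card V) :
    Fintype.card V * (greenMatrix a b).trace = Fintype.card V - Fintype.card ι
      + Fintype.card V * ((Fintype.card V : ℝ) • (1 : Matrix ι ι ℝ)
        - (orientedIncidence a b)ᵀ * orientedIncidence a b)⁻¹.trace := by
  have hV : (Fintype.card V : ℝ) ≠ 0 := by
    have : (0 : ℝ) ≤ Fintype.card ι := Nat.cast_nonneg _
    linarith
  have hmul := mul_nonsing_inv _ (isUnit_iff_ne_zero.2 (det_scalar_sub_ne_zero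
      (orientedIncidence_gram_diag hne) (fun _ _ => abs_orientedIncidence_gram_le hne hinj) hc))
  unfold greenMatrix
  set X := ((Fintype.card V : ℝ) • (1 : Matrix ι ι ℝ)
    - (orientedIncidence a b)ᵀ * orientedIncidence a b)⁻¹
  set B := orientedIncidence a b
  have h1 : Bᵀ * B * X = (Fintype.card V : ℝ) • X - 1 := by
    rw [← hmul, Matrix.sub_mul, Matrix.smul_mul, Matrix.one_mul]
    abel
  rw [trace_smul, trace_add, trace_one, trace_mul_comm, ← Matrix.mul_assoc, h1, trace_sub,
    trace_smul, trace_one, smul_eq_mul, smul_eq_mul, mul_inv_cancel_left₀ hV]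
  ring

-- The indicator of a component lies in the kernel of `L`; after subtracting its mean it is also
-- killed by `J`, hence by the invertible `n - B Bᵀ`. So the indicator is constant.
open Matrix in
theorem connected_of_missing {V ι : Type*} [Fintype V] [DecidableEq V] [Fintype ι]
    [DecidableEq ι] (G : SimpleGraph V) [DecidableRel G.Adj] {a b : ι → V}
    (hne : ∀ e, a e ≠ b e) (hinj : Function.Injective fun e => s(a e, b e))
    (hadj : ∀ u v, G.Adj u v ↔ u ≠ v ∧ ∀ e, s(a e, b e) ≠ s(u, v))
    (hc : (Fintype.card ι : ℝ) + 1 < Fintype.card V) : G.Connected := by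
  classical
  have hV : (0 : ℝ) < Fintype.card V := by
    have : (0 : ℝ) ≤ Fintype.card ι := Nat.cast_nonneg _
    linarith
  have hne' : Nonempty V := Fintype.card_pos_iff.1 (by exact_mod_cast hV)
  refine ⟨fun u v => ?_⟩
  set x : V → ℝ := fun w => if G.Reachable u w then 1 else 0 with hx
  have hL : (G.lapMatrix ℝ).mulVec x = 0 := by
    rw [G.lapMatrix_mulVec_eq_zero_iff_forall_reachable]
    intro i j hij
    have : G.Reachable u i ↔ G.Reachable u j := ⟨fun h => h.trans hij, fun h => h.trans hij.symm⟩
    simp [hx, this]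
  set t : ℝ := (∑ w, x w) / Fintype.card V with ht
  have hconst : (orientedIncidence a b)ᵀ *ᵥ (fun _ => t) = 0 := by
    ext e
    rw [orientedIncidence_transpose_mulVec, sub_self]
    rfl
  have hW : ((Fintype.card V : ℝ) • (1 : Matrix V V ℝ)
      - orientedIncidence a b * (orientedIncidence a b)ᵀ) *ᵥ (x - fun _ => t) = 0 := by
    ext w
    have h1 := lapMatrix_eq_of_missing G hne hinj hadj x w
    rw [hL] at h1
    rw [mulVec_sub, sub_mulVec, sub_mulVec, smul_mulVec, smul_mulVec, one_mulVec, one_mulVec,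
      ← mulVec_mulVec (fun _ => t), hconst, mulVec_zero]
    have h2 : (Fintype.card V : ℝ) * t = ∑ w, x w := by rw [ht]; field_simp
    simp only [Pi.sub_apply, Pi.smul_apply, Pi.zero_apply, smul_eq_mul, h2] at h1 ⊢
    linarith
  have hZ := mul_eq_one_comm.1 (mul_greenMatrix hne hinj hc)
  have hx0 : x - (fun _ => t) = 0 := by
    rw [← one_mulVec (x - fun _ => t), ← hZ, ← mulVec_mulVec, hW, mulVec_zero]
  have h1 := congrFun hx0 u
  have h2 := congrFun hx0 v
  by_contra hnot
  simp [hx, hnot] at h1 h2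
  simp [h2] at h1

-- The difference of columns `i` and `j` of the inverse of `L + J` has zero sum, so `L` alone maps
-- it to the unit current.
open Matrix in
theorem resistanceDist_eq_greenMatrix {V ι : Type*} [Fintype V] [DecidableEq V] [Fintype ι]
    [DecidableEq ι] (G : SimpleGraph V) [DecidableRel G.Adj] {a b : ι → V}
    (hne : ∀ e, a e ≠ b e) (hinj : Function.Injective fun e => s(a e, b e))
    (hadj : ∀ u v, G.Adj u v ↔ u ≠ v ∧ ∀ e, s(a e, b e) ≠ s(u, v))
    (hc : (Fintype.card ι : ℝ) + 1 < Fintype.card V) (i j : V) :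
    G.resistanceDist i j = (greenMatrix a b i i - greenMatrix a b i j)
      - (greenMatrix a b j i - greenMatrix a b j j) := by
  refine G.resistanceDist_eq (φ := fun v => greenMatrix a b v i - greenMatrix a b v j)
    (connected_of_missing G hne hinj hadj hc) ?_
  rw [SimpleGraph.isUnitCurrentPotential_iff]
  have hφ : (fun v => greenMatrix a b v i - greenMatrix a b v j)
      = greenMatrix a b *ᵥ (Pi.single i 1 - Pi.single j 1) := by
    ext v
    simp [mulVec_sub]
  have hW : ((Fintype.card V : ℝ) • (1 : Matrix V V ℝ)
      - orientedIncidence a b * (orientedIncidence a b)ᵀ) *ᵥ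
        (fun v => greenMatrix a b v i - greenMatrix a b v j)
      = Pi.single i 1 - Pi.single j 1 := by
    rw [hφ, mulVec_mulVec, mul_greenMatrix hne hinj hc, one_mulVec]
  ext v
  rw [lapMatrix_eq_of_missing G hne hinj hadj, Finset.sum_sub_distrib, sum_col_greenMatrix,
    sum_col_greenMatrix, sub_self, sub_zero, ← hW, sub_mulVec, smul_mulVec, one_mulVec]
  rfl

open Matrix in
theorem kirchhoffIndex_eq_trace {n : ℕ} {ι : Type*} [Fintype ι] [DecidableEq ι]
    (G : SimpleGraph (Fin n)) [DecidableRel G.Adj] {a b : ι → Fin n}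
    (hne : ∀ e, a e ≠ b e) (hinj : Function.Injective fun e => s(a e, b e))
    (hadj : ∀ u v, G.Adj u v ↔ u ≠ v ∧ ∀ e, s(a e, b e) ≠ s(u, v))
    (hc : (Fintype.card ι : ℝ) + 1 < n) :
    G.kirchhoffIndex = n - 1 - Fintype.card ι + n * ((n : ℝ) • (1 : Matrix ι ι ℝ)
        - (orientedIncidence a b)ᵀ * orientedIncidence a b)⁻¹.trace := by
  have hn : (n : ℝ) ≠ 0 := by
    have : (0 : ℝ) ≤ Fintype.card ι := Nat.cast_nonneg _
    linarith
  have hc' : (Fintype.card ι : ℝ) + 1 < Fintype.card (Fin n) := by rwa [Fintype.card_fin]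
  have htr := card_mul_trace_greenMatrix hne hinj hc'
  have hsum : ∑ i, ∑ j, greenMatrix a b i j = 1 := by
    rw [Finset.sum_comm (f := fun i j => greenMatrix a b i j)]
    simp [sum_col_greenMatrix, hn]
  simp only [SimpleGraph.kirchhoffIndex, resistanceDist_eq_greenMatrix G hne hinj hadj hc']
  rw [sum_Ioi_symmetrized, hsum]
  simp only [Fintype.card_fin] at htr
  rw [htr]
  ring

/-! ### Upper bound and the value for a star -/

theorem kirchhoffIndex_le_of_missing {n : ℕ} {ι : Type*} [Fintype ι] [DecidableEq ι]
    (G : SimpleGraph (Fin n)) [DecidableRel G.Adj] {a b : ι → Fin n}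
    (hne : ∀ e, a e ≠ b e) (hinj : Function.Injective fun e => s(a e, b e))
    (hadj : ∀ u v, G.Adj u v ↔ u ≠ v ∧ ∀ e, s(a e, b e) ≠ s(u, v))
    (hc : (Fintype.card ι : ℝ) + 1 < n) :
    G.kirchhoffIndex ≤ n - 1 - Fintype.card ι + n * (Fintype.card ι *
      ((n - Fintype.card ι) / ((n - 1) * (n - 1 - Fintype.card ι)))) := by
  rw [kirchhoffIndex_eq_trace G hne hinj hadj hc]
  gcongr
  rw [Matrix.trace, ← nsmul_eq_mul, ← Finset.card_univ, ← Finset.sum_const]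
  exact Finset.sum_le_sum fun e _ => inv_scalar_sub_diag_le (orientedIncidence_gram_diag hne)
    (fun _ _ => abs_orientedIncidence_gram_le hne hinj) hc e

open Matrix in
theorem kirchhoffIndex_eq_of_missing_star {n : ℕ} {ι : Type*} [Fintype ι] [DecidableEq ι]
    (G : SimpleGraph (Fin n)) [DecidableRel G.Adj] {c : Fin n} {b : ι → Fin n}
    (hne : ∀ e, c ≠ b e) (hinj : Function.Injective b)
    (hadj : ∀ u v, G.Adj u v ↔ u ≠ v ∧ ∀ e, s(c, b e) ≠ s(u, v))
    (hc : (Fintype.card ι : ℝ) + 1 < n) :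
    G.kirchhoffIndex = n - 1 - Fintype.card ι + n * (Fintype.card ι *
      ((n - Fintype.card ι) / ((n - 1) * (n - 1 - Fintype.card ι)))) := by
  have hinj' : Function.Injective fun e => s(c, b e) := fun e f h => hinj (Sym2.congr_right.1 h)
  rw [kirchhoffIndex_eq_trace G hne hinj' hadj hc]
  have hp : (0 : ℝ) ≤ Fintype.card ι := Nat.cast_nonneg _
  have h1 : (n : ℝ) - 1 ≠ 0 := by linarith
  have h2 : (n : ℝ) - 1 - Fintype.card ι ≠ 0 := by linarith
  -- With every edge leaving the centre, all off-diagonal Gram entries are `+1`, and `n - 1 - J` is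
  -- inverted using `J² = p J`.
  have hgram : (orientedIncidence (fun _ => c) b)ᵀ * orientedIncidence (fun _ => c) b
      = (1 : Matrix ι ι ℝ) + of fun _ _ => 1 := by
    ext e f
    rw [orientedIncidence_gram_apply]
    simp [hne, (hne _).symm, hinj.eq_iff, one_apply, add_comm]
  have hinv : ((n : ℝ) • (1 : Matrix ι ι ℝ)
        - (orientedIncidence (fun _ => c) b)ᵀ * orientedIncidence (fun _ => c) b)⁻¹
      = ((n : ℝ) - 1)⁻¹ • ((1 : Matrix ι ι ℝ)
        + ((n : ℝ) - 1 - Fintype.card ι)⁻¹ • of fun _ _ => 1) := by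
    refine inv_eq_right_inv ?_
    rw [hgram]
    have hJ : (of fun _ _ => 1 : Matrix ι ι ℝ) * (of fun _ _ => 1)
        = (Fintype.card ι : ℝ) • of fun _ _ => 1 := by
      ext; simp [mul_apply]
    rw [Matrix.mul_smul, Matrix.mul_add, Matrix.mul_one, Matrix.mul_smul, Matrix.sub_mul,
      Matrix.add_mul, hJ, Matrix.smul_mul, Matrix.one_mul]
    ext e f
    simp only [Matrix.add_apply, Matrix.sub_apply, Matrix.smul_apply, of_apply, smul_eq_mul]
    field_simp
    ring
  rw [hinv]
  simp only [trace, diag, Matrix.add_apply, Matrix.smul_apply, of_apply, one_apply_eq,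
    Finset.sum_const, Finset.card_univ, smul_eq_mul, nsmul_eq_mul]
  field_simp
  ring

/-! ### Recognising a star among the missing edges -/

theorem completeMinusStar_adj {n p : ℕ} {x y : Fin n} :
    (completeMinusStar n p).Adj x y ↔ x ≠ y ∧
      ¬ (((x : ℕ) = 0 ∧ 1 ≤ (y : ℕ) ∧ (y : ℕ) ≤ p) ∨
        ((y : ℕ) = 0 ∧ 1 ≤ (x : ℕ) ∧ (x : ℕ) ≤ p)) := by
  simp only [completeMinusStar, starSubgraph, SimpleGraph.deleteEdges_adj, SimpleGraph.top_adj,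
    SimpleGraph.mem_edgeSet, SimpleGraph.fromRel_adj]
  tauto

/-- The vertices joined to `v` by an edge in `S`. -/
def missingNeighbors {V : Type*} [Fintype V] [DecidableEq V] (S : Finset (Sym2 V)) (v : V) :
    Finset V :=
  Finset.univ.filter fun w => s(v, w) ∈ S

theorem card_missingNeighbors_add_degree {V : Type*} [Fintype V] [DecidableEq V]
    (G : SimpleGraph V) [DecidableRel G.Adj] {S : Finset (Sym2 V)}
    (hloop : ∀ v, s(v, v) ∉ S) (hadj : ∀ u v, G.Adj u v ↔ u ≠ v ∧ s(u, v) ∉ S) (v : V) :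
    (missingNeighbors S v).card + G.degree v + 1 = Fintype.card V := by
  have h1 : G.neighborFinset v = (insert v (missingNeighbors S v))ᶜ := by
    ext w
    simp [hadj, missingNeighbors, eq_comm]
  have h2 : v ∉ missingNeighbors S v := by simp [missingNeighbors, hloop]
  rw [← G.card_neighborFinset_eq_degree, h1, ← Finset.card_add_card_compl
    (insert v (missingNeighbors S v)), Finset.card_insert_of_notMem h2]
  ring

theorem image_missingNeighbors_subset {V : Type*} [Fintype V] [DecidableEq V]
    (S : Finset (Sym2 V)) (v : V) : (missingNeighbors S v).image (fun w => s(v, w)) ⊆ S := by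
  intro e he
  obtain ⟨w, hw, rfl⟩ := Finset.mem_image.1 he
  exact (Finset.mem_filter.1 hw).2

theorem card_image_missingNeighbors {V : Type*} [Fintype V] [DecidableEq V]
    (S : Finset (Sym2 V)) (v : V) :
    ((missingNeighbors S v).image fun w => s(v, w)).card = (missingNeighbors S v).card :=
  Finset.card_image_of_injective _ fun _ _ h => Sym2.congr_right.1 h

theorem card_missingNeighbors_le {V : Type*} [Fintype V] [DecidableEq V]
    (S : Finset (Sym2 V)) (v : V) : (missingNeighbors S v).card ≤ S.card :=
  card_image_missingNeighbors S v ▸ Finset.card_le_card (image_missingNeighbors_subset S v)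

theorem mem_iff_of_card_missingNeighbors_eq {V : Type*} [Fintype V] [DecidableEq V]
    {S : Finset (Sym2 V)} {c : V} (hc : (missingNeighbors S c).card = S.card) (u v : V) :
    s(u, v) ∈ S ↔ (u = c ∧ v ∈ missingNeighbors S c) ∨ (v = c ∧ u ∈ missingNeighbors S c) := by
  -- As many edges of `S` meet `c` as `S` has in total, so all of them do.
  have himage := Finset.eq_of_subset_of_card_le (image_missingNeighbors_subset S c)
    (by rw [card_image_missingNeighbors, hc])
  nth_rewrite 1 [← himage]
  simp only [Finset.mem_image, Sym2.eq_iff]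
  constructor
  · rintro ⟨w, hw, ⟨rfl, rfl⟩ | ⟨rfl, rfl⟩⟩
    · exact Or.inl ⟨rfl, hw⟩
    · exact Or.inr ⟨rfl, hw⟩
  · rintro (⟨rfl, hw⟩ | ⟨rfl, hw⟩)
    · exact ⟨v, hw, Or.inl ⟨rfl, rfl⟩⟩
    · exact ⟨u, hw, Or.inr ⟨rfl, rfl⟩⟩

theorem exists_perm_star {n p : ℕ} (hpn : p < n) {D : Finset (Fin n)} {c : Fin n}
    (hcD : c ∉ D) (hD : D.card = p) :
    ∃ g : Fin n ≃ Fin n, (∀ x, g x = c ↔ (x : ℕ) = 0) ∧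
      ∀ x, g x ∈ D ↔ 1 ≤ (x : ℕ) ∧ (x : ℕ) ≤ p := by
  -- Labels `1, …, p` enumerate `D`. The default `c` is intended at `0` and junk above `p`, so
  -- injectivity is claimed only for labels `≤ p` and the map is then extended to a permutation.
  let f : Fin n → Fin n := fun i =>
    if h : 1 ≤ (i : ℕ) ∧ (i : ℕ) ≤ p then D.orderEmbOfFin hD ⟨i - 1, by omega⟩ else c
  have hf0 : ∀ i : Fin n, (i : ℕ) = 0 → f i = c := fun i hi => dif_neg (by omega)
  have hf1 : ∀ i : Fin n, 1 ≤ (i : ℕ) → (i : ℕ) ≤ p → f i ∈ D := fun i h1 h2 => by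
    simp only [f, dif_pos (And.intro h1 h2)]
    exact D.orderEmbOfFin_mem hD _
  have hinj : Set.InjOn f (Finset.univ.filter fun i : Fin n => (i : ℕ) ≤ p) := by
    intro i hi j hj hij
    simp only [Finset.coe_filter, Finset.mem_univ, true_and, Set.mem_ofPred_eq] at hi hj
    by_cases h1 : (i : ℕ) = 0 <;> by_cases h2 : (j : ℕ) = 0
    · exact Fin.ext (h1.trans h2.symm)
    · exact absurd (hf0 i h1 ▸ hij ▸ hf1 j (by omega) hj) hcD
    · exact absurd (hf0 j h2 ▸ hij ▸ hf1 i (by omega) hi) hcD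
    · simp only [f, dif_pos (And.intro (Nat.one_le_iff_ne_zero.2 h1) hi),
        dif_pos (And.intro (Nat.one_le_iff_ne_zero.2 h2) hj)] at hij
      have := (D.orderEmbOfFin hD).injective hij
      simp only [Fin.mk.injEq] at this
      exact Fin.ext (by omega)
  obtain ⟨g', hg'⟩ := Finset.exists_equiv_extend_of_card_eq (t := Finset.univ) (by simp)
    (Finset.subset_univ _) hinj
  let g : Fin n ≃ Fin n := g'.trans (Equiv.subtypeUnivEquiv fun x => Finset.mem_univ x)
  have hg : ∀ i : Fin n, (i : ℕ) ≤ p → g i = f i := fun i hi => hg' i (by simp [hi])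
  refine ⟨g, fun x => ⟨fun h => ?_, fun h => (hg x (by omega)).trans (hf0 x h)⟩,
    fun x => ⟨fun h => ?_, fun h => (hg x h.2).symm ▸ hf1 x h.1 h.2⟩⟩
  · have h0 : g ⟨0, by omega⟩ = c := (hg _ (Nat.zero_le _)).trans (hf0 _ rfl)
    rw [← h0, g.apply_eq_iff_eq] at h
    rw [h]
  · rw [← Finset.mem_coe, ← D.range_orderEmbOfFin hD] at h
    obtain ⟨k, hk⟩ := h
    have hk' : g ⟨k + 1, by omega⟩ = g x := by
      rw [hg _ (by simp), ← hk]
      have : 1 ≤ (k : ℕ) + 1 ∧ (k : ℕ) + 1 ≤ p := by omega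
      simp only [f, dif_pos this]
      rfl
    rw [g.apply_eq_iff_eq] at hk'
    rw [← hk']
    simp only
    omega

theorem nonempty_iso_completeMinusStar {n p : ℕ} (hpn : p < n) (G : SimpleGraph (Fin n))
    {S : Finset (Sym2 (Fin n))} (hcard : S.card = p) (hloop : ∀ v, s(v, v) ∉ S)
    (hadj : ∀ u v, G.Adj u v ↔ u ≠ v ∧ s(u, v) ∉ S) {c : Fin n}
    (hc : (missingNeighbors S c).card = p) : Nonempty (G ≃g completeMinusStar n p) := by
  have hcD : c ∉ missingNeighbors S c := by simp [missingNeighbors, hloop]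
  obtain ⟨g, hg0, hg1⟩ := exists_perm_star hpn hcD hc
  refine ⟨RelIso.symm ⟨g, fun {x y} => ?_⟩⟩
  rw [hadj, completeMinusStar_adj, mem_iff_of_card_missingNeighbors_eq (hc.trans hcard.symm),
    hg0, hg0, hg1, hg1, g.apply_eq_iff_eq.ne]

theorem kirchhoffIndex_and_degree_of_iso_completeMinusStar {n p : ℕ} (hpn : p + 1 < n)
    (G : SimpleGraph (Fin n)) [DecidableRel G.Adj] (F : G ≃g completeMinusStar n p) :
    G.kirchhoffIndex = n - 1 - p + n * (p * ((n - p) / ((n - 1) * (n - 1 - p)))) ∧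
      ∃ c, G.degree c + p + 1 ≤ n := by
  let c : Fin n := F.symm ⟨0, by omega⟩
  let b : Fin p → Fin n := fun e => F.symm ⟨e + 1, by omega⟩
  have hne : ∀ e, c ≠ b e := fun e h => by simpa using F.symm.injective h
  have hinj : Function.Injective b := fun e f h => by
    simpa [Fin.ext_iff] using F.symm.injective h
  have hadj : ∀ u v, G.Adj u v ↔ u ≠ v ∧ ∀ e, s(c, b e) ≠ s(u, v) := by
    intro u v
    rw [← F.map_adj_iff, completeMinusStar_adj, F.injective.ne_iff, ← not_exists]
    have hc : ∀ u, c = u ↔ (F u : ℕ) = 0 := fun u => by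
      rw [← F.injective.eq_iff]
      simp [c, Fin.ext_iff, eq_comm]
    have hb : ∀ e u, b e = u ↔ (F u : ℕ) = e + 1 := fun e u => by
      rw [← F.injective.eq_iff]
      simp [b, Fin.ext_iff, eq_comm]
    have hex : ∀ u, (∃ e, b e = u) ↔ 1 ≤ (F u : ℕ) ∧ (F u : ℕ) ≤ p := fun u => by
      simp only [hb]
      refine ⟨fun ⟨e, he⟩ => by omega, fun h => ⟨⟨F u - 1, by omega⟩, by simp only; omega⟩⟩
    simp only [Sym2.eq_iff, exists_or, exists_and_left, hc, hex]
  refine ⟨?_, c, ?_⟩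
  · have h := kirchhoffIndex_eq_of_missing_star G hne hinj hadj
      (by rw [Fintype.card_fin]; exact_mod_cast hpn)
    rwa [Fintype.card_fin] at h
  · have hsub : G.neighborFinset c ⊆ (insert c (Finset.univ.image b))ᶜ := by
      intro w hw
      rw [SimpleGraph.mem_neighborFinset, hadj] at hw
      simp only [Finset.mem_compl, Finset.mem_insert, Finset.mem_image, Finset.mem_univ, true_and,
        not_or, not_exists]
      exact ⟨hw.1.symm, fun e he => hw.2 e (by rw [he])⟩
    have hle := Finset.card_le_card hsub
    rw [Finset.card_compl, Finset.card_insert_of_notMem (by simpa using fun e => (hne e).symm),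
      Finset.card_image_of_injective _ hinj, Finset.card_univ, Fintype.card_fin, Fintype.card_fin,
      G.card_neighborFinset_eq_degree] at hle
    omega

/-! ### The main theorem -/

theorem corollary3p1 (n p : ℕ) (hp : 2 ≤ p) (hpn : p ≤ n / 2)
    (G : SimpleGraph (Fin n)) [DecidableRel G.Adj]
    (S : Finset (Sym2 (Fin n))) (hS : S ⊆ (⊤ : SimpleGraph (Fin n)).edgeFinset)
    (hcard : S.card = p)
    (hG : G = (⊤ : SimpleGraph (Fin n)).deleteEdges (S : Set (Sym2 (Fin n)))) :
    G.kirchhoffIndex ≤ (n : ℝ) - 1 - p + n / (n - p - 1)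
        + n * (p - 1) * G.minDegree / ((n - 1) * (n - p - 1)) ∧
      (G.kirchhoffIndex = (n : ℝ) - 1 - p + n / (n - p - 1)
          + n * (p - 1) * G.minDegree / ((n - 1) * (n - p - 1)) ↔
        Nonempty (G ≃g completeMinusStar n p)) := by
  have hpn' : p + 1 < n := by omega
  have hadj : ∀ u v, G.Adj u v ↔ u ≠ v ∧ s(u, v) ∉ S := by simp [hG]
  have hloop : ∀ v, s(v, v) ∉ S := fun v hv => by simpa using hS hv
  have hdeg := card_missingNeighbors_add_degree G hloop hadj
  rw [Fintype.card_fin] at hdeg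
  have : Nonempty (Fin n) := ⟨⟨0, by omega⟩⟩
  obtain ⟨c, hc⟩ := G.exists_minimal_degree_vertex
  have hδ : n ≤ G.minDegree + p + 1 := by
    have h1 := hdeg c
    have h2 := card_missingNeighbors_le S c
    omega
  have hpR : (2 : ℝ) ≤ p := by exact_mod_cast hp
  have hpnR : (p : ℝ) + 1 < n := by exact_mod_cast hpn'
  have hδR : (n : ℝ) ≤ G.minDegree + p + 1 := by exact_mod_cast hδ
  have hd1 : 0 < (n : ℝ) - 1 := by linarith
  have hd2 : 0 < (n : ℝ) - p - 1 := by linarith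
  -- Split the bound into the star value and the excess of `δ` over its least possible value `n - 1
  -- - p`.
  have hbound : (n : ℝ) - 1 - p + n / (n - p - 1)
        + n * (p - 1) * G.minDegree / ((n - 1) * (n - p - 1))
      = (n - 1 - p + n * (p * ((n - p) / ((n - 1) * (n - 1 - p)))))
        + n * (p - 1) / ((n - 1) * (n - p - 1)) * (G.minDegree + p + 1 - n) := by
    rw [sub_right_comm (n : ℝ) 1 p]
    field_simp
    ring
  -- Strict positivity uses `p ≥ 2`; without it equality would say nothing about `δ`.
  have hcoef : 0 < (n : ℝ) * (p - 1) / ((n - 1) * (n - p - 1)) :=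
    div_pos (mul_pos (by linarith) (by linarith)) (mul_pos hd1 hd2)
  have hle : G.kirchhoffIndex ≤ n - 1 - p + n * (p * ((n - p) / ((n - 1) * (n - 1 - p)))) := by
    -- Any orientation of the missing edges will do; `out` picks one.
    have hout : ∀ e : S, s(e.1.out.1, e.1.out.2) = e.1 := fun e => Quot.out_eq e.1
    have h := kirchhoffIndex_le_of_missing G (a := fun e : S => e.1.out.1)
      (b := fun e : S => e.1.out.2) (fun e he => hloop e.1.out.1 ?_) (fun e f hef => ?_)
      (fun u v => ?_) ?_
    · rwa [Fintype.card_coe, hcard] at h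
    · have h : s(e.1.out.1, e.1.out.2) ∈ S := (hout e).symm ▸ e.2
      rwa [← he] at h
    · simp only [hout] at hef
      exact Subtype.ext hef
    · rw [hadj]
      simp only [hout]
      exact and_congr_right fun _ => ⟨fun h e he => h (he ▸ e.2), fun h he => h ⟨_, he⟩ rfl⟩
    · rwa [Fintype.card_coe, hcard]
  rw [hbound]
  have hnonneg := mul_nonneg hcoef.le (show (0 : ℝ) ≤ G.minDegree + p + 1 - n by linarith)
  refine ⟨by linarith, fun heq => ?_, fun ⟨F⟩ => ?_⟩
  -- Equality leaves no room for the excess term, so a vertex of minimum degree misses exactly `p`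
  -- neighbours.
  · have h0 : (G.minDegree : ℝ) + p + 1 - n = 0 := by
      have := mul_eq_zero.1 (le_antisymm (by linarith) hnonneg)
      exact this.resolve_left hcoef.ne'
    have h1 : G.minDegree + p + 1 = n := by exact_mod_cast sub_eq_zero.1 h0
    refine nonempty_iso_completeMinusStar (by omega) G hcard hloop hadj (c := c) ?_
    have := hdeg c
    omega
  · obtain ⟨hK, v, hv⟩ := kirchhoffIndex_and_degree_of_iso_completeMinusStar hpn' G F
    have h1 : G.minDegree + p + 1 = n := by
      have := G.minDegree_le_degree v
      omega
    have h2 : (G.minDegree : ℝ) + p + 1 - n = 0 := sub_eq_zero.2 (by exact_mod_cast h1)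
    rw [hK, h2, mul_zero, add_zero]
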